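/- A colored graph is a finite simple undirected graph in which every vertex has at most one color from a palette $C$ containing at least five colors. Let $\mathrm{FO}^2$ be first-order logic with two variables over equality, adjacency and one unary predicate for each color, with formulas in negation normal form. The alternation depth of a formula is the maximum length of a sequence of nested alternating quantifiers in it, so a sentence of alternation depth $a$ has $a-1$ quantifier alternations. A sentence distinguishes $G$ from $H$ if it is true on $G$ and false on $H$. Let $A^2(G,H)$ be the minimum alternation depth of an $\mathrm{FO}^2$ sentence distinguishing $G$ from $H$, and let $A^2(n)$ be the maximum of $A^2(G,H)$ over all pairs of $n$-vertex colored graphs $G,H$ such that $G$ is distinguishable from $H$ in $\mathrm{FO}^2$. Theorem. For every $n\ge 1$, this maximum exists and $$\frac n8-2<A^2(n)\le n+1 .$$ Moreover, for every $m\ge 2$ the following graphs $G=2G_m$ and $H=2H_m$, both with $8m-4$ vertices, are distinguishable in $\mathrm{FO}^2$ by a sentence with $m-2$ quantifier alternations but by no $\mathrm{FO}^2$ sentence with fewer, that is, $A^2(G,H)=m-1$. The ladder $A_m$ has vertices $l_i,r_i$ for $0\le i<m$; for $0\le i<m-1$ it has the edges $l_il_{i+1}$ and $r_ir_{i+1}$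 and one slanted edge, which is $l_ir_{i+1}$ if $i$ is even and $r_il_{i+1}$ if $i$ is odd. The vertices $l_0,r_0$ are green, $l_{m-1}$ is red, $r_{m-1}$ is blue, and all other vertices are uncolored. The ladder $B_m$ is obtained from $A_m$ by recoloring red to apricot and blue to cyan. The graph $G_m$ is obtained from disjoint copies of $A_m$ and $B_m$ by identifying the two vertices $l_0$ with each other and the two vertices $r_0$ with each other; $H_m$ is obtained by identifying $l_0$ of each ladder with $r_0$ of the other one. Finally, $2G_m$ and $2H_m$ consist of two disjoint copies of $G_m$ and of $H_m$, respectively. -/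

import Mathlib

/-- A colored graph on the vertex set `V`: a simple undirected graph, each vertex of which has one
color from the palette `C` or is uncolored (`none`). -/
structure ColoredGraph (C : Type*) (V : Type*) where
  graph : SimpleGraph V
  color : V → Option C

/-- First-order formulas in negation normal form over the vocabulary of colored graphs (equality,
adjacency, one unary predicate for each color in `C`), using only the `k` variables indexed by
`Fin k`; a variable may be quantified repeatedly. -/
inductive FOFormula (C : Type*) (k : ℕ) where
  | eq (i j : Fin k)
  | neq (i j : Fin k)
  | adj (i j : Fin k)
  | nadj (i j : Fin k)
  | col (c : C) (i : Fin k)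
  | ncol (c : C) (i : Fin k)
  | and (φ ψ : FOFormula C k)
  | or (φ ψ : FOFormula C k)
  | ex (i : Fin k) (φ : FOFormula C k)
  | all (i : Fin k) (φ : FOFormula C k)

namespace FOFormula

/-- The set of free variables. -/
def freeVars {C : Type*} {k : ℕ} : FOFormula C k → Finset (Fin k)
  | eq i j => {i, j}
  | neq i j => {i, j}
  | adj i j => {i, j}
  | nadj i j => {i, j}
  | col _ i => {i}
  | ncol _ i => {i}
  | and φ ψ => φ.freeVars ∪ ψ.freeVars
  | or φ ψ => φ.freeVars ∪ ψ.freeVars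
  | ex i φ => φ.freeVars.erase i
  | all i φ => φ.freeVars.erase i

/-- Truth of a formula in a colored graph under an assignment of vertices to variables. -/
def Realize {C : Type*} {k : ℕ} {V : Type*} (G : ColoredGraph C V) :
    FOFormula C k → (Fin k → V) → Prop
  | eq i j, v => v i = v j
  | neq i j, v => v i ≠ v j
  | adj i j, v => G.graph.Adj (v i) (v j)
  | nadj i j, v => ¬ G.graph.Adj (v i) (v j)
  | col c i, v => G.color (v i) = some c
  | ncol c i, v => G.color (v i) ≠ some c
  | and φ ψ, v => φ.Realize G v ∧ ψ.Realize G v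
  | or φ ψ, v => φ.Realize G v ∨ ψ.Realize G v
  | ex i φ, v => ∃ x : V, φ.Realize G (Function.update v i x)
  | all i φ, v => ∀ x : V, φ.Realize G (Function.update v i x)

/-- The maximum number of quantifier blocks along a branch of the formula, not counting a first
block that continues a block of quantifiers already opened above the formula. The first argument
tells which block is open: `none` for no block, `some true` for `∃`, `some false` for `∀`. -/
def blocks {C : Type*} {k : ℕ} : Option Bool → FOFormula C k → ℕ
  | _, eq _ _ => 0
  | _, neq _ _ => 0
  | _, adj _ _ => 0
  | _, nadj _ _ => 0
  | _, col _ _ => 0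
  | _, ncol _ _ => 0
  | q, and φ ψ => max (φ.blocks q) (ψ.blocks q)
  | q, or φ ψ => max (φ.blocks q) (ψ.blocks q)
  | q, ex _ φ => (if q = some true then 0 else 1) + φ.blocks (some true)
  | q, all _ φ => (if q = some false then 0 else 1) + φ.blocks (some false)

/-- The alternation depth: the maximum length of a sequence of nested alternating quantifiers. A
sentence with alternation depth `a ≥ 1` has `a - 1` quantifier alternations. -/
def altDepth {C : Type*} {k : ℕ} (φ : FOFormula C k) : ℕ := φ.blocks none

/-- `φ` is a sentence that is true on `G` but false on `H`. (On nonempty structures the truth of a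
sentence does not depend on the assignment.) -/
def Distinguishes {C : Type*} {k : ℕ} {V W : Type*} (φ : FOFormula C k)
    (G : ColoredGraph C V) (H : ColoredGraph C W) : Prop :=
  φ.freeVars = ∅ ∧ (∀ v : Fin k → V, φ.Realize G v) ∧ ¬ ∀ w : Fin k → W, φ.Realize H w

end FOFormula

/-- `G` is distinguishable from `H` in `k`-variable first-order logic. -/
def Distinguishable {C : Type*} {V W : Type*} (k : ℕ)
    (G : ColoredGraph C V) (H : ColoredGraph C W) : Prop :=
  ∃ φ : FOFormula C k, φ.Distinguishes G H

/-- `A^k(G,H)`: the minimum alternation depth of a `k`-variable sentence distinguishing `G`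
from `H`. It is only used for distinguishable pairs. -/
noncomputable def minAltDepth {C : Type*} {V W : Type*} (k : ℕ)
    (G : ColoredGraph C V) (H : ColoredGraph C W) : ℕ :=
  sInf {a : ℕ | ∃ φ : FOFormula C k, φ.Distinguishes G H ∧ φ.altDepth = a}

/-- The values `A^k(G,H)` for all pairs of `n`-vertex colored graphs over the palette `C` that are
distinguishable in `k`-variable logic. -/
def altValues (C : Type*) (k n : ℕ) : Set ℕ :=
  {a : ℕ | ∃ (V W : Type) (_ : Fintype V) (_ : Fintype W)
    (G : ColoredGraph C V) (H : ColoredGraph C W),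
    Fintype.card V = n ∧ Fintype.card W = n ∧ Distinguishable k G H ∧ minAltDepth k G H = a}

/-- The alternation function `A^k(n)` over colored graphs with palette `C`. -/
noncomputable def altFunction (C : Type*) (k n : ℕ) : ℕ := sSup (altValues C k n)

/-- The five colors of the ladder graphs. -/
inductive Hue where
  | red | blue | green | apricot | cyan

/-- The edges of a ladder going from rung `i` up to rung `j`; the vertex `(i, false)` is the left
and `(i, true)` the right vertex of rung `i`. Between consecutive rungs there are the two upright
edges and one slanted edge; the slanted edge starts at the left vertex of rung `i` if `i` is even
and at the right vertex if `i` is odd. There are no edges within a rung. -/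
def ladderUp (x y : ℕ × Bool) : Prop :=
  y.1 = x.1 + 1 ∧
    (x.2 = y.2 ∨ (Even x.1 ∧ x.2 = false ∧ y.2 = true) ∨
      (Odd x.1 ∧ x.2 = true ∧ y.2 = false))

/-- Adjacency in a ladder. -/
def ladderAdj (x y : ℕ × Bool) : Prop := ladderUp x y ∨ ladderUp y x

/-- Two ladders `A_m` and `B_m` with `m ≥ 2` rungs each, glued together at their bottom rungs. The
vertices are arranged in `2m - 1` horizontal rungs. Rung `m - 1` is the common bottom rung; the
vertex `(m - 1 + i, s)` is the vertex `(i, s)` of `A_m`, and the vertex `(m - 1 - i, s)` is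
the vertex `(i, s xor t)` of `B_m`. So the bit `t` selects one of the two ways of gluing: left to
left and right to right (`t = false`), or left to right and right to left (`t = true`).
The bottom rung of the ladders is green, the left and the right top vertices of `A_m` are red and
blue, those of `B_m` are apricot and cyan; the remaining vertices are uncolored. -/
def gluedLadders {C : Type*} (κ : Hue ↪ C) (m : ℕ) (t : Bool) :
    ColoredGraph C (Fin (2 * m - 1) × Bool) where
  graph :=
    { Adj := fun u v =>
        (m - 1 ≤ u.1.val ∧ m - 1 ≤ v.1.val ∧
          ladderAdj (u.1.val - (m - 1), u.2) (v.1.val - (m - 1), v.2)) ∨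
        (u.1.val ≤ m - 1 ∧ v.1.val ≤ m - 1 ∧
          ladderAdj (m - 1 - u.1.val, xor u.2 t) (m - 1 - v.1.val, xor v.2 t))
      symm := ⟨fun _ _ h => h.imp (fun ⟨a, b, c⟩ => ⟨b, a, c.symm⟩)
        (fun ⟨a, b, c⟩ => ⟨b, a, c.symm⟩)⟩
      loopless := ⟨fun u h => by
        simp [ladderAdj, ladderUp] at h⟩ }
  color := fun u =>
    if u.1.val = m - 1 then some (κ Hue.green)
    else if u.1.val = 2 * m - 2 then
      some (κ (if u.2 = false then Hue.red else Hue.blue))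
    else if u.1.val = 0 then
      some (κ (if xor u.2 t = false then Hue.apricot else Hue.cyan))
    else none

/-- The disjoint union of two copies of a colored graph. -/
def ColoredGraph.double {C : Type*} {V : Type*} (G : ColoredGraph C V) :
    ColoredGraph C (V ⊕ V) where
  graph := SimpleGraph.sum G.graph G.graph
  color := Sum.elim G.color G.color

/-! Truth of two-variable sentences is controlled by a pebble game in which only changes of side are
charged: within a block of equal quantifiers Spoiler keeps playing in the same graph at no cost. So
a bound on alternation depth needs two families of relations, `E a` and `U a`, with `a` alternations
left. Each is closed under arbitrarily many moves in one graph, and losing one alternation passes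
from one family to the other (`realize_of_forth`).

Upper bound: vertex types of quantifier depth `i` refine each other as `i` grows and must stabilize
before round `n`. If no sentence of alternation depth at most `n + 1` distinguishes the graphs, both
realize the same types up to depth `n`. Equality of stable types is then a winning strategy for
Duplicator of any length, so no sentence distinguishes them (`Distinguishable.exists_altDepth_le`).

Lower bound: each rung of a ladder has one narrow and one wide vertex, and vertices of consecutive
rungs are adjacent unless both are narrow (`ladderAdj_iff`). If the pebbled vertices differ in
width, Duplicator answers with a wide vertex, which is adjacent to the whole next rung. This fails
only when Spoiler goes from a wide to a narrow vertex. The harmful difference is thereby turned into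
the harmless one (Spoiler narrow, Duplicator wide), which becomes harmful again only when Spoiler
changes sides. Hence each rung toward the colored end costs an alternation (`Near.step`), and far
from both ends the twist at the green rung is invisible (`localForth_rungNear`). The second copy of
the graph makes nonadjacent moves trivial (`LocalForth.double`).

Conversely, width is definable rung by rung from the colored top downward, at one alternation per
rung (`forks_gluedLadders_iff`). The distinguishing sentence asks for a green vertex that is wide in
both ladders. Padding with isolated vertices gives all other orders. -/

/-! ### Syntax and semantics: negation, renaming, conjunction. -/

namespace FOFormula

variable {C : Type*} {k : ℕ} {V W : Type*}

/-- The negation of a formula, pushed down to the atoms. -/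
def neg : FOFormula C k → FOFormula C k
  | eq i j => neq i j
  | neq i j => eq i j
  | adj i j => nadj i j
  | nadj i j => adj i j
  | col c i => ncol c i
  | ncol c i => col c i
  | and φ ψ => or φ.neg ψ.neg
  | or φ ψ => and φ.neg ψ.neg
  | ex i φ => all i φ.neg
  | all i φ => ex i φ.neg

/-- The quantifier depth. -/
def qdepth : FOFormula C k → ℕ
  | eq _ _ => 0
  | neq _ _ => 0
  | adj _ _ => 0
  | nadj _ _ => 0
  | col _ _ => 0
  | ncol _ _ => 0
  | and φ ψ => max φ.qdepth ψ.qdepth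
  | or φ ψ => max φ.qdepth ψ.qdepth
  | ex _ φ => φ.qdepth + 1
  | all _ φ => φ.qdepth + 1

/-- Renaming of all variables, free and bound. -/
def rename (e : Fin k → Fin k) : FOFormula C k → FOFormula C k
  | eq i j => eq (e i) (e j)
  | neq i j => neq (e i) (e j)
  | adj i j => adj (e i) (e j)
  | nadj i j => nadj (e i) (e j)
  | col c i => col c (e i)
  | ncol c i => ncol c (e i)
  | and φ ψ => and (φ.rename e) (ψ.rename e)
  | or φ ψ => or (φ.rename e) (ψ.rename e)
  | ex i φ => ex (e i) (φ.rename e)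
  | all i φ => all (e i) (φ.rename e)

/-- The conjunction of a list of formulas; the empty conjunction is `eq j j`. -/
def conj (j : Fin k) (l : List (FOFormula C k)) : FOFormula C k := l.foldr and (eq j j)

@[simp] theorem realize_neg (G : ColoredGraph C V) (φ : FOFormula C k) (v : Fin k → V) :
    φ.neg.Realize G v ↔ ¬ φ.Realize G v := by
  induction φ generalizing v with
  | and φ ψ hφ hψ => simp only [neg, Realize, hφ, hψ]; tauto
  | or φ ψ hφ hψ => simp only [neg, Realize, hφ, hψ]; tauto
  | ex i φ hφ => simp [neg, Realize, hφ]
  | all i φ hφ => simp [neg, Realize, hφ]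
  | _ => simp [neg, Realize]

@[simp] theorem qdepth_neg (φ : FOFormula C k) : φ.neg.qdepth = φ.qdepth := by
  induction φ <;> simp_all [neg, qdepth]

@[simp] theorem freeVars_neg (φ : FOFormula C k) : φ.neg.freeVars = φ.freeVars := by
  induction φ <;> simp_all [neg, freeVars]

theorem blocks_neg (q : Option Bool) (φ : FOFormula C k) :
    φ.neg.blocks (q.map not) = φ.blocks q := by
  induction φ generalizing q with
  | ex i φ hφ =>
    have := hφ (some true)
    rcases q with _ | _ | _ <;> simp_all [neg, blocks]
  | all i φ hφ =>
    have := hφ (some false)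
    rcases q with _ | _ | _ <;> simp_all [neg, blocks]
  | _ => simp_all [neg, blocks]

theorem blocks_le_qdepth (q : Option Bool) (φ : FOFormula C k) : φ.blocks q ≤ φ.qdepth := by
  induction φ generalizing q with
  | and φ ψ hφ hψ => exact max_le_max (hφ q) (hψ q)
  | or φ ψ hφ hψ => exact max_le_max (hφ q) (hψ q)
  | ex i φ hφ => have := hφ (some true); simp only [blocks, qdepth]; split <;> omega
  | all i φ hφ => have := hφ (some false); simp only [blocks, qdepth]; split <;> omega
  | _ => simp [blocks]

@[simp] theorem qdepth_rename (e : Fin k → Fin k) (φ : FOFormula C k) :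
    (φ.rename e).qdepth = φ.qdepth := by
  induction φ <;> simp_all [rename, qdepth]

theorem realize_rename (G : ColoredGraph C V) {e : Fin k → Fin k} (he : e.Injective)
    (φ : FOFormula C k) (v : Fin k → V) :
    (φ.rename e).Realize G v ↔ φ.Realize G (v ∘ e) := by
  induction φ generalizing v <;>
    simp_all [rename, Realize, Function.update_comp_eq_of_injective]

theorem realize_congr (G : ColoredGraph C V) (φ : FOFormula C k) {v w : Fin k → V}
    (h : ∀ i ∈ φ.freeVars, v i = w i) : φ.Realize G v ↔ φ.Realize G w := by
  have key : ∀ (i : Fin k) (φ : FOFormula C k) (v w : Fin k → V) (x : V),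
      (∀ j ∈ φ.freeVars.erase i, v j = w j) →
      ∀ j ∈ φ.freeVars, Function.update v i x j = Function.update w i x j := by
    intro i φ v w x h j hj
    by_cases hji : j = i
    · subst hji; simp
    · simpa [hji] using h j (Finset.mem_erase.2 ⟨hji, hj⟩)
  induction φ generalizing v w with
  | and φ ψ hφ hψ =>
    exact and_congr (hφ fun i hi => h i (Finset.mem_union_left _ hi))
      (hψ fun i hi => h i (Finset.mem_union_right _ hi))
  | or φ ψ hφ hψ =>
    exact or_congr (hφ fun i hi => h i (Finset.mem_union_left _ hi))
      (hψ fun i hi => h i (Finset.mem_union_right _ hi))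
  | ex i φ hφ => exact exists_congr fun x => hφ (key i φ v w x h)
  | all i φ hφ => exact forall_congr' fun x => hφ (key i φ v w x h)
  | _ => simp_all [Realize, freeVars]

@[simp] theorem realize_conj (G : ColoredGraph C V) (j : Fin k) (l : List (FOFormula C k))
    (v : Fin k → V) : (conj j l).Realize G v ↔ ∀ φ ∈ l, φ.Realize G v := by
  induction l <;> simp_all [conj, Realize]

theorem qdepth_conj_le {j : Fin k} {l : List (FOFormula C k)} {d : ℕ}
    (h : ∀ φ ∈ l, φ.qdepth ≤ d) : (conj j l).qdepth ≤ d := by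
  induction l <;> simp_all [conj, qdepth]

theorem freeVars_conj_subset {j : Fin k} {l : List (FOFormula C k)}
    (h : ∀ φ ∈ l, φ.freeVars ⊆ {j}) : (conj j l).freeVars ⊆ {j} := by
  induction l with
  | nil => simp [conj, freeVars]
  | cons φ l ih =>
    simp only [conj, List.foldr, freeVars]
    exact Finset.union_subset (h φ (by simp)) (ih fun ψ hψ => h ψ (by simp [hψ]))

end FOFormula

/-! ### The one-sided pebble game for alternation depth. -/

/-- Every move in `G` from a vertex `x` can be answered in `H` from any vertex related to `x`. -/
structure Forth {C V W : Type*} (G : ColoredGraph C V) (H : ColoredGraph C W)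
    (R : V → W → Prop) : Prop where
  color : ∀ {x y}, R x y → G.color x = H.color y
  move : ∀ {x y}, R x y → ∀ x', ∃ y', R x' y' ∧ (x' = x ↔ y' = y) ∧
    (G.graph.Adj x' x ↔ H.graph.Adj y' y)

section Game

variable {C V W : Type*} {G : ColoredGraph C V} {H : ColoredGraph C W}

/-- Equality and adjacency among the assigned vertices agree. -/
def AtomicAgree {k : ℕ} (G : ColoredGraph C V) (H : ColoredGraph C W)
    (v : Fin k → V) (w : Fin k → W) : Prop :=
  ∀ i j, (v i = v j ↔ w i = w j) ∧ (G.graph.Adj (v i) (v j) ↔ H.graph.Adj (w i) (w j))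

theorem AtomicAgree.symm {k : ℕ} {v : Fin k → V} {w : Fin k → W} (h : AtomicAgree G H v w) :
    AtomicAgree H G w v := fun i j => ⟨(h i j).1.symm, (h i j).2.symm⟩

theorem Fin.eq_or_eq_add_one (i j : Fin 2) : j = i ∨ j = i + 1 := by
  revert i j; decide

theorem Fin.two_add_one_ne (i : Fin 2) : i + 1 ≠ i := by
  revert i; decide

theorem Forth.exists_update {R : V → W → Prop} (hR : Forth G H R) {v : Fin 2 → V} {w : Fin 2 → W}
    (hvw : ∀ i, R (v i) (w i)) (i : Fin 2) (x : V) :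
    ∃ y, AtomicAgree G H (Function.update v i x) (Function.update w i y) ∧
      ∀ j, R (Function.update v i x j) (Function.update w i y j) := by
  obtain ⟨y, hy, heq, hadj⟩ := hR.move (hvw (i + 1)) x
  have hi := Fin.two_add_one_ne i
  refine ⟨y, fun j l => ?_, fun j => ?_⟩
  · rcases Fin.eq_or_eq_add_one i j with hj | hj <;>
      rcases Fin.eq_or_eq_add_one i l with hl | hl <;> rw [hj, hl]
    · simp
    · simpa [hi] using ⟨heq, hadj⟩
    · simpa [hi, eq_comm, SimpleGraph.adj_comm] using ⟨heq, hadj⟩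
    · simp [hi]
  · rcases Fin.eq_or_eq_add_one i j with rfl | rfl
    · simpa using hy
    · simpa [hi] using hvw _

/-- A quantifier continuing the open block keeps the relation and the budget `a`; one opening a new
block spends one unit, and `hEU` or `hUE` supplies the relation for the other side. The two claims,
for an open `∃` block and an open `∀` block, need each other and are proved in one induction. -/
theorem realize_of_forth {E U : ℕ → V → W → Prop} {d : ℕ}
    (hE : ∀ a < d, Forth G H (E a)) (hU : ∀ a < d, Forth H G (flip (U a)))
    (hEU : ∀ a x y, E (a + 1) x y → U a x y) (hUE : ∀ a x y, U (a + 1) x y → E a x y)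
    (φ : FOFormula C 2) {a : ℕ} (ha : a < d) {v : Fin 2 → V} {w : Fin 2 → W}
    (hvw : AtomicAgree G H v w) :
    ((∀ i, E a (v i) (w i)) → φ.blocks (some true) ≤ a → φ.Realize G v → φ.Realize H w) ∧
    ((∀ i, U a (v i) (w i)) → φ.blocks (some false) ≤ a → φ.Realize G v → φ.Realize H w) := by
  have hc : ∀ i, (E a (v i) (w i) ∨ U a (v i) (w i)) → G.color (v i) = H.color (w i) :=
    fun i h => h.elim (hE a ha).color fun h => ((hU a ha).color h).symm
  induction φ generalizing a v w with
  | eq i j => exact ⟨fun _ _ => (hvw i j).1.1, fun _ _ => (hvw i j).1.1⟩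
  | neq i j => exact ⟨fun _ _ => mt (hvw i j).1.2, fun _ _ => mt (hvw i j).1.2⟩
  | adj i j => exact ⟨fun _ _ => (hvw i j).2.1, fun _ _ => (hvw i j).2.1⟩
  | nadj i j => exact ⟨fun _ _ => mt (hvw i j).2.2, fun _ _ => mt (hvw i j).2.2⟩
  | col c i =>
    constructor <;> intro h _ <;> simp only [FOFormula.Realize] <;> rw [hc i (by simp [h i])] <;>
      exact id
  | ncol c i =>
    constructor <;> intro h _ <;> simp only [FOFormula.Realize] <;> rw [hc i (by simp [h i])] <;>
      exact id
  | and φ ψ hφ hψ =>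
    simp only [FOFormula.Realize, FOFormula.blocks, max_le_iff]
    exact ⟨fun h hb hr => ⟨(hφ ha hvw hc).1 h hb.1 hr.1, (hψ ha hvw hc).1 h hb.2 hr.2⟩,
      fun h hb hr => ⟨(hφ ha hvw hc).2 h hb.1 hr.1, (hψ ha hvw hc).2 h hb.2 hr.2⟩⟩
  | or φ ψ hφ hψ =>
    simp only [FOFormula.Realize, FOFormula.blocks, max_le_iff]
    exact ⟨fun h hb hr => hr.imp ((hφ ha hvw hc).1 h hb.1) ((hψ ha hvw hc).1 h hb.2),
      fun h hb hr => hr.imp ((hφ ha hvw hc).2 h hb.1) ((hψ ha hvw hc).2 h hb.2)⟩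
  | ex i φ ih =>
    have main : ∀ b < d, (∀ i, E b (v i) (w i)) → φ.blocks (some true) ≤ b →
        (FOFormula.ex i φ).Realize G v → (FOFormula.ex i φ).Realize H w := by
      rintro b hbd h hb ⟨x, hx⟩
      obtain ⟨y, hy, hy'⟩ := (hE b hbd).exists_update h i x
      exact ⟨y, (ih hbd hy fun j h => h.elim (hE b hbd).color
        fun h => ((hU b hbd).color h).symm).1 hy' hb hx⟩
    refine ⟨fun h hb => main a ha h (by simpa [FOFormula.blocks] using hb), fun h hb => ?_⟩
    obtain ⟨b, rfl⟩ : ∃ b, a = b + 1 := ⟨a - 1, by simp [FOFormula.blocks] at hb; omega⟩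
    exact main b (by omega) (fun i => hUE b _ _ (h i)) (by simp [FOFormula.blocks] at hb; omega)
  | all i φ ih =>
    have main : ∀ b < d, (∀ i, U b (v i) (w i)) → φ.blocks (some false) ≤ b →
        (FOFormula.all i φ).Realize G v → (FOFormula.all i φ).Realize H w := by
      intro b hbd h hb hx y
      obtain ⟨x, hy, hy'⟩ := (hU b hbd).exists_update h i y
      exact (ih hbd hy.symm fun j h => h.elim (hE b hbd).color
        fun h => ((hU b hbd).color h).symm).2 hy' hb (hx x)
    refine ⟨fun h hb => ?_, fun h hb => main a ha h (by simpa [FOFormula.blocks] using hb)⟩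
    obtain ⟨b, rfl⟩ : ∃ b, a = b + 1 := ⟨a - 1, by simp [FOFormula.blocks] at hb; omega⟩
    exact main b (by omega) (fun i => hEU b _ _ (h i)) (by simp [FOFormula.blocks] at hb; omega)

theorem realize_sentence_of_forth {E U : ℕ → V → W → Prop} {d : ℕ}
    (hE : ∀ a < d, Forth G H (E a)) (hU : ∀ a < d, Forth H G (flip (U a)))
    (hEU : ∀ a x y, E (a + 1) x y → U a x y) (hUE : ∀ a x y, U (a + 1) x y → E a x y)
    (hEtot : ∀ a < d, ∀ x, ∃ y, E a x y) (hUtot : ∀ a < d, ∀ y, ∃ x, U a x y)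
    (φ : FOFormula C 2) (hfree : φ.freeVars = ∅) (hd : φ.altDepth ≤ d)
    (v : Fin 2 → V) (w : Fin 2 → W) (h : φ.Realize G v) : φ.Realize H w := by
  have hconst : ∀ x y, AtomicAgree (k := 2) G H (fun _ => x) (fun _ => y) := fun x y i j => by simp
  unfold FOFormula.altDepth at hd
  induction φ with
  | and φ ψ hφ hψ =>
    simp only [FOFormula.freeVars, Finset.union_eq_empty, FOFormula.blocks, max_le_iff] at hfree hd
    exact ⟨hφ hfree.1 hd.1 h.1, hψ hfree.2 hd.2 h.2⟩
  | or φ ψ hφ hψ =>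
    simp only [FOFormula.freeVars, Finset.union_eq_empty, FOFormula.blocks, max_le_iff] at hfree hd
    exact h.imp (hφ hfree.1 hd.1) (hψ hfree.2 hd.2)
  | ex i φ =>
    have hi : ∀ j ∈ φ.freeVars, j = i := by
      simpa [FOFormula.freeVars, Finset.erase_eq_empty_iff, Finset.subset_singleton_iff',
        ← Finset.subset_singleton_iff] using hfree
    simp only [FOFormula.blocks, reduceCtorEq, if_false] at hd
    obtain ⟨x, hx⟩ := h
    obtain ⟨y, hy⟩ := hEtot (d - 1) (by omega) x
    refine ⟨y, ?_⟩
    -- Only the variable just quantified is free, so both pebbles may be placed on the same vertex,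
    -- which makes the atomic agreement automatic.
    rw [φ.realize_congr H (w := fun _ => y) fun j hj => by simp [hi j hj]]
    rw [φ.realize_congr G (w := fun _ => x) fun j hj => by simp [hi j hj]] at hx
    exact (realize_of_forth hE hU hEU hUE φ (a := d - 1) (by omega) (hconst x y)).1
      (fun _ => hy) (by omega) hx
  | all i φ =>
    have hi : ∀ j ∈ φ.freeVars, j = i := by
      simpa [FOFormula.freeVars, Finset.erase_eq_empty_iff, Finset.subset_singleton_iff',
        ← Finset.subset_singleton_iff] using hfree
    simp only [FOFormula.blocks, reduceCtorEq, if_false] at hd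
    intro y
    obtain ⟨x, hy⟩ := hUtot (d - 1) (by omega) y
    have hx := h x
    rw [φ.realize_congr H (w := fun _ => y) fun j hj => by simp [hi j hj]]
    rw [φ.realize_congr G (w := fun _ => x) fun j hj => by simp [hi j hj]] at hx
    exact (realize_of_forth hE hU hEU hUE φ (a := d - 1) (by omega) (hconst x y)).2
      (fun _ => hy) (by omega) hx
  | _ => simp [FOFormula.freeVars] at hfree

end Game

/-! ### Upper bound: stabilization of vertex types. -/

section Refinement

open FOFormula

variable {C V W : Type*} {G : ColoredGraph C V} {H : ColoredGraph C W}

/-- The `2`-variable type of depth `i` of a vertex. -/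
def vertexType (G : ColoredGraph C V) (i : ℕ) (x : V) : Set (FOFormula C 2) :=
  {φ | φ.qdepth ≤ i ∧ φ.freeVars ⊆ {0} ∧ φ.Realize G fun _ => x}

theorem vertexType_restrict (G : ColoredGraph C V) (i : ℕ) (x : V) :
    vertexType G i x = {φ ∈ vertexType G (i + 1) x | φ.qdepth ≤ i} := by
  ext φ
  simp only [vertexType, Set.mem_ofPred_eq]
  constructor
  · rintro ⟨h1, h2, h3⟩; exact ⟨⟨by omega, h2, h3⟩, h1⟩
  · rintro ⟨⟨_, h2, h3⟩, h1⟩; exact ⟨h1, h2, h3⟩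

theorem color_eq_of_vertexType_eq {i : ℕ} {x : V} {y : W}
    (h : vertexType G i x = vertexType H i y) : G.color x = H.color y := by
  ext c
  have := Set.ext_iff.1 h (col c 0)
  simpa [vertexType, qdepth, freeVars, Realize] using this

theorem exists_separating {i : ℕ} {x : V} {y : W} (h : vertexType G i x ≠ vertexType H i y) :
    ∃ φ : FOFormula C 2, φ.qdepth ≤ i ∧ φ.freeVars ⊆ {0} ∧
      φ.Realize G (fun _ => x) ∧ ¬ φ.Realize H fun _ => y := by
  by_contra hn
  push Not at hn
  refine h (Set.ext fun φ => ⟨fun ⟨h1, h2, h3⟩ => ⟨h1, h2, hn φ h1 h2 h3⟩,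
    fun ⟨h1, h2, h3⟩ => ⟨h1, h2, ?_⟩⟩)
  by_contra h4
  exact (realize_neg H φ _).1 (hn φ.neg (by simpa) (by rwa [freeVars_neg]) (by simpa)) h3

theorem realize_rename_swap {ψ : FOFormula C 2} (hψ : ψ.freeVars ⊆ {0}) (x x' : V) :
    (ψ.rename (Equiv.swap 0 1)).Realize G (Function.update (fun _ => x) 1 x') ↔
      ψ.Realize G fun _ => x' := by
  rw [realize_rename G (Equiv.swap (0 : Fin 2) 1).injective]
  refine realize_congr G ψ fun j hj => ?_
  rw [Finset.mem_singleton.1 (hψ hj)]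
  simp

/-- If every candidate answer failed, one formula per vertex of `H` would refute it. Their
conjunction, with the equality and adjacency pattern of `x'` to `x`, becomes after one quantifier a
formula of depth `i + 1` true at `x` and false at `y`. The conjunction runs over the vertices of
`H`, not over all types, so the palette may be infinite. -/
theorem exists_move_of_vertexType_eq [Finite W] {i : ℕ} {x : V} {y : W}
    (h : vertexType G (i + 1) x = vertexType H (i + 1) y) (x' : V) :
    ∃ y', vertexType G i x' = vertexType H i y' ∧ (x' = x ↔ y' = y) ∧
      (G.graph.Adj x' x ↔ H.graph.Adj y' y) := by
  classical
  have := Fintype.ofFinite W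
  by_contra! hn
  have hf : ∀ y', ∃ φ : FOFormula C 2, φ.qdepth ≤ i ∧ φ.freeVars ⊆ {0} ∧
      φ.Realize G (fun _ => x') ∧ ((x' = x ↔ y' = y) → (G.graph.Adj x' x ↔ H.graph.Adj y' y) →
        ¬ φ.Realize H fun _ => y') := by
    intro y'
    by_cases ht : vertexType G i x' = vertexType H i y'
    · refine ⟨eq 0 0, by simp [qdepth], by simp [freeVars], by simp [Realize], fun h1 h2 => ?_⟩
      have := hn y' ht h1
      tauto
    · obtain ⟨φ, h1, h2, h3, h4⟩ := exists_separating ht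
      exact ⟨φ, h1, h2, h3, fun _ _ => h4⟩
  choose f hf1 hf2 hf3 hf4 using hf
  let ψ := conj 0 (Finset.univ.toList.map f)
  let e : FOFormula C 2 := if x' = x then eq 1 0 else neq 1 0
  let b : FOFormula C 2 := if G.graph.Adj x' x then adj 1 0 else nadj 1 0
  let χ : FOFormula C 2 := ex 1 (and e (and b (ψ.rename (Equiv.swap 0 1))))
  have hψfree : ψ.freeVars ⊆ {0} := freeVars_conj_subset (by simpa using hf2)
  have hψq : ψ.qdepth ≤ i := qdepth_conj_le (by simpa using hf1)
  have hχ : χ ∈ vertexType G (i + 1) x := by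
    refine ⟨?_, fun j _ => ?_, x', ?_, ?_, ?_⟩
    · have he : e.qdepth = 0 := by simp only [e]; split <;> rfl
      have hb : b.qdepth = 0 := by simp only [b]; split <;> rfl
      simp [χ, qdepth, he, hb, hψq]
    · simp only [χ, freeVars, Finset.mem_erase] at *
      simp; omega
    · simp only [e]; split <;> simpa [Realize]
    · simp only [b]; split <;> simpa [Realize]
    · rw [realize_rename_swap hψfree]; simpa [ψ] using hf3
  rw [h] at hχ
  obtain ⟨-, -, y', he, hb, hr⟩ := hχ
  rw [realize_rename_swap hψfree] at hr
  refine hf4 y' ?_ ?_ ((realize_conj _ _ _ _).1 hr (f y') (by simp))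
  · simp only [e] at he; split at he <;> simp_all [Realize]
  · simp only [b] at hb; split at hb <;> simp_all [Realize]

theorem exists_sentence_of_notMem_range [Finite W] {i : ℕ} {x : V}
    (h : vertexType G i x ∉ Set.range (vertexType H i)) :
    ∃ φ : FOFormula C 2, φ.freeVars = ∅ ∧ φ.qdepth ≤ i + 1 ∧ (∀ v, φ.Realize G v) ∧
      ∀ w, ¬ φ.Realize H w := by
  have := Fintype.ofFinite W
  have hf : ∀ y, vertexType G i x ≠ vertexType H i y := fun y hy => h ⟨y, hy.symm⟩
  choose f hf1 hf2 hf3 hf4 using fun y => exists_separating (hf y)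
  let ψ := conj 0 (Finset.univ.toList.map f)
  have hψfree : ψ.freeVars ⊆ {0} := freeVars_conj_subset (by simpa using hf2)
  have hψq : ψ.qdepth ≤ i := qdepth_conj_le (by simpa using hf1)
  refine ⟨ex 0 ψ, ?_, by simpa [qdepth], fun v => ⟨x, ?_⟩, ?_⟩
  · simpa [freeVars, Finset.erase_eq_empty_iff, Finset.subset_singleton_iff] using hψfree
  · rw [realize_congr G ψ (w := fun _ => x) fun j hj => by
      rw [Finset.mem_singleton.1 (hψfree hj)]; simp]
    simpa [ψ] using hf3
  · rintro w ⟨y, hy⟩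
    rw [realize_congr H ψ (w := fun _ => y) fun j hj => by
      rw [Finset.mem_singleton.1 (hψfree hj)]; simp] at hy
    exact hf4 y ((realize_conj _ _ _ _).1 hy (f y) (by simp))

/-- Restriction maps the types of depth `i + 1` onto those of depth `i`. If it were never injective
in the first `Nat.card V` rounds, the number of types would grow from at least 1 by at least 1 per
round and exceed the number of vertices. -/
theorem exists_stable_round [Finite V] [Nonempty V] (G : ColoredGraph C V) :
    ∃ i < Nat.card V, Set.InjOn (fun s => {φ ∈ s | φ.qdepth ≤ i})
      (Set.range (vertexType G (i + 1))) := by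
  by_contra! hn
  have himage : ∀ i, (fun s => {φ ∈ s | φ.qdepth ≤ i}) '' Set.range (vertexType G (i + 1)) =
      Set.range (vertexType G i) := by
    intro i
    rw [← Set.range_comp]
    exact congrArg _ (funext fun x => (vertexType_restrict G i x).symm)
  have hgrow : ∀ i ≤ Nat.card V, i + 1 ≤ (Set.range (vertexType G i)).ncard := by
    intro i hi
    induction i with
    | zero => exact (Set.ncard_pos (Set.finite_range _)).2 (Set.range_nonempty _)
    | succ i ih =>
      have h1 := ih (by omega)
      have h2 : (Set.range (vertexType G i)).ncard ≤ (Set.range (vertexType G (i + 1))).ncard := by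
        rw [← himage i]; exact Set.ncard_image_le (Set.finite_range _)
      have h3 : (Set.range (vertexType G i)).ncard ≠
          (Set.range (vertexType G (i + 1))).ncard := by
        intro heq
        rw [← himage i] at heq
        exact hn i (by omega) (Set.injOn_of_ncard_image_eq heq (Set.finite_range _))
      omega
  have h1 := hgrow _ le_rfl
  have h2 : (Set.range (vertexType G (Nat.card V))).ncard ≤ Nat.card V := by
    rw [← Set.image_univ, ← Set.ncard_univ]; exact Set.ncard_image_le
  omega

theorem Distinguishable.exists_altDepth_le [Finite V] [Finite W] [Nonempty V]
    (h : Distinguishable 2 G H) :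
    ∃ φ : FOFormula C 2, φ.Distinguishes G H ∧ φ.altDepth ≤ Nat.card V + 1 := by
  obtain ⟨φ, hφ, hG, hH⟩ := h
  by_contra! hn
  have hW : Nonempty W := by
    by_contra hW
    rw [not_nonempty_iff] at hW
    exact hH fun w => isEmptyElim (w 0)
  have hrange : ∀ i ≤ Nat.card V, Set.range (vertexType G i) = Set.range (vertexType H i) := by
    intro i hi
    apply Set.Subset.antisymm
    · rintro _ ⟨x, rfl⟩
      by_contra hx
      obtain ⟨ψ, h1, h2, h3, h4⟩ := exists_sentence_of_notMem_range hx
      have := hn ψ ⟨h1, h3, fun h => h4 (fun _ => hW.some) (h _)⟩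
      have := ψ.blocks_le_qdepth none
      unfold altDepth at *
      omega
    · rintro _ ⟨y, rfl⟩
      by_contra hy
      obtain ⟨ψ, h1, h2, h3, h4⟩ := exists_sentence_of_notMem_range hy
      have := hn ψ.neg ⟨by simpa, by simpa using h4, fun h => by
        simpa [h3] using h fun _ => hW.some⟩
      have := ψ.neg.blocks_le_qdepth none
      rw [qdepth_neg] at this
      unfold altDepth at *
      omega
  obtain ⟨i, hi, hinj⟩ := exists_stable_round G
  have hstable : ∀ x y, vertexType G i x = vertexType H i y →
      vertexType G (i + 1) x = vertexType H (i + 1) y := by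
    intro x y hxy
    refine hinj ⟨x, rfl⟩ (by rw [hrange _ (by omega)]; exact ⟨y, rfl⟩) ?_
    simpa only [← vertexType_restrict] using hxy
  -- By stability this single relation survives moves on either side, so it serves as both `E a` and
  -- `U a` for every `a`.
  let R : ℕ → V → W → Prop := fun _ x y => vertexType G i x = vertexType H i y
  have hE : ∀ a, Forth G H (R a) := fun a =>
    ⟨color_eq_of_vertexType_eq, fun hxy => exists_move_of_vertexType_eq (hstable _ _ hxy)⟩
  have hU : ∀ a, Forth H G (flip (R a)) := fun a =>
    ⟨fun hxy => (color_eq_of_vertexType_eq hxy).symm, fun hxy y' => by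
      obtain ⟨x', h1, h2⟩ := exists_move_of_vertexType_eq (hstable _ _ hxy).symm y'
      exact ⟨x', h1.symm, h2⟩⟩
  refine hH fun w => realize_sentence_of_forth (fun a _ => hE a) (fun a _ => hU a)
    (fun _ _ _ => id) (fun _ _ _ => id) (d := φ.altDepth) (fun a _ x => ?_) (fun a _ y => ?_) φ hφ le_rfl _ w
    (hG fun _ => Classical.arbitrary V)
  · obtain ⟨y, hy⟩ := (hrange i hi.le).subset ⟨x, rfl⟩
    exact ⟨y, hy.symm⟩
  · exact (hrange i hi.le).symm.subset ⟨y, rfl⟩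

end Refinement

/-! ### Doubling, padding and bounded morphisms. -/

section Constructions

variable {C V W : Type*} {G : ColoredGraph C V} {H : ColoredGraph C W}

/-- The disjoint union of a colored graph with `p` isolated uncolored vertices. -/
def ColoredGraph.pad (G : ColoredGraph C V) (p : ℕ) : ColoredGraph C (V ⊕ Fin p) where
  graph := SimpleGraph.sum G.graph ⊥
  color := Sum.elim G.color fun _ => none

/-- Every step along an edge of `G` can be answered in `H`, and every vertex of `G` is related to
some vertex of `H`. -/
structure LocalForth (G : ColoredGraph C V) (H : ColoredGraph C W) (R : V → W → Prop) : Prop where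
  color : ∀ {x y}, R x y → G.color x = H.color y
  step : ∀ {x y}, R x y → ∀ x', G.graph.Adj x x' → ∃ y', R x' y' ∧ H.graph.Adj y y'
  total : ∀ x, ∃ y, R x y

/-- A move to a distinct nonadjacent vertex is answered in the copy of `H` that does not contain
`y`, where inequality and nonadjacency come for free. Only moves along edges require a strategy. -/
theorem LocalForth.double {R : V → W → Prop} (hR : LocalForth G H R) :
    Forth G.double H.double fun x y => R (Sum.elim id id x) (Sum.elim id id y) := by
  refine ⟨fun {x y} h => ?_, fun {x y} h x' => ?_⟩
  · have := hR.color h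
    rcases x with x | x <;> rcases y with y | y <;> simpa [ColoredGraph.double] using this
  · by_cases hxx : x' = x
    · subst hxx
      exact ⟨y, h, by simp, by simp⟩
    · by_cases hadj : G.double.graph.Adj x' x
      · have hb : G.graph.Adj (Sum.elim id id x) (Sum.elim id id x') := by
          rcases x with x | x <;> rcases x' with x' | x' <;>
            simp_all [ColoredGraph.double, SimpleGraph.adj_comm]
        obtain ⟨y', h1, h2⟩ := hR.step h _ hb
        rcases y with y | y
        · refine ⟨.inl y', h1, ?_, ?_⟩
          · simpa [hxx] using h2.ne'
          · exact iff_of_true hadj h2.symm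
        · refine ⟨.inr y', h1, ?_, ?_⟩
          · simpa [hxx] using h2.ne'
          · exact iff_of_true hadj h2.symm
      · obtain ⟨y', h1⟩ := hR.total (Sum.elim id id x')
        rcases y with y | y
        · exact ⟨.inr y', h1, by simp [hxx], iff_of_false hadj (by simp [ColoredGraph.double])⟩
        · exact ⟨.inl y', h1, by simp [hxx], iff_of_false hadj (by simp [ColoredGraph.double])⟩

theorem LocalForth.double_total {R : V → W → Prop} (hR : LocalForth G H R) (x : V ⊕ V) :
    ∃ y : W ⊕ W, R (Sum.elim id id x) (Sum.elim id id y) := by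
  obtain ⟨y, hy⟩ := hR.total (Sum.elim id id x)
  exact ⟨.inl y, hy⟩

theorem Forth.pad {R : V → W → Prop} (hR : Forth G H R) (htot : ∀ x, ∃ y, R x y) (p : ℕ) :
    Forth (G.pad p) (H.pad p) (Sum.LiftRel R Eq) := by
  refine ⟨fun {x y} h => ?_, fun {x y} h x' => ?_⟩
  · rcases h with h | h
    · exact hR.color h
    · rfl
  · rcases h with h | rfl <;> rcases x' with x' | j
    · obtain ⟨y', h1, h2, h3⟩ := hR.move h x'
      exact ⟨.inl y', .inl h1, by simpa, by simpa [ColoredGraph.pad]⟩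
    · exact ⟨.inr j, .inr rfl, by simp, by simp [ColoredGraph.pad]⟩
    · obtain ⟨y', h1⟩ := htot x'
      exact ⟨.inl y', .inl h1, by simp, by simp [ColoredGraph.pad]⟩
    · exact ⟨.inr j, .inr rfl, by simp, by simp [ColoredGraph.pad]⟩

theorem liftRel_total {R : V → W → Prop} (htot : ∀ x, ∃ y, R x y) {p : ℕ} (x : V ⊕ Fin p) :
    ∃ y, Sum.LiftRel R (Eq : Fin p → Fin p → Prop) x y := by
  rcases x with x | j
  · obtain ⟨y, hy⟩ := htot x
    exact ⟨.inl y, .inl hy⟩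
  · exact ⟨.inr j, .inr rfl⟩

/-- A color-preserving map under which the neighbors of the image of `x` are the images of the
neighbors of `x`. -/
structure BoundedMorphism (G : ColoredGraph C V) (H : ColoredGraph C W) (f : V → W) : Prop where
  color : ∀ x, H.color (f x) = G.color x
  adj : ∀ x z, H.graph.Adj (f x) z ↔ ∃ x', f x' = z ∧ G.graph.Adj x x'

theorem BoundedMorphism.exists_adj {f : V → W} (hf : BoundedMorphism G H f) (P : W → Prop) (x : V) :
    (∃ z, H.graph.Adj (f x) z ∧ P z) ↔ ∃ x', G.graph.Adj x x' ∧ P (f x') := by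
  simp only [hf.adj]
  constructor
  · rintro ⟨_, ⟨x', rfl, h⟩, hP⟩; exact ⟨x', h, hP⟩
  · rintro ⟨x', h, hP⟩; exact ⟨_, ⟨x', rfl, h⟩, hP⟩

theorem boundedMorphism_double (G : ColoredGraph C V) :
    BoundedMorphism G.double G (Sum.elim id id) := by
  refine ⟨fun x => by rcases x with x | x <;> rfl, fun x z => ?_⟩
  rcases x with x | x <;> simp [ColoredGraph.double]

theorem boundedMorphism_pad (G : ColoredGraph C V) (p : ℕ) :
    BoundedMorphism G (G.pad p) Sum.inl := by
  refine ⟨fun x => rfl, fun x z => ?_⟩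
  rcases z with z | z <;> simp [ColoredGraph.pad]

end Constructions

/-! ### Formulas defining width along a ladder. -/

section ForkFormulas

open FOFormula

variable {C V W : Type*}

/-- `exNbr F i` says that `F` holds for some neighbor of the vertex assigned to `i`. -/
def exNbr (F : Fin 2 → FOFormula C 2) (i : Fin 2) : FOFormula C 2 :=
  ex (i + 1) (and (adj i (i + 1)) (F (i + 1)))

/-- There is a walk of a given length to a vertex of color `c` or `c'`. -/
def walkFormula (c c' : C) : ℕ → Fin 2 → FOFormula C 2
  | 0, i => or (col c i) (col c' i)
  | l + 1, i => exNbr (walkFormula c c' l) i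

/-- The formula `∃ y (x ~ y ∧ ¬ (walk y ∨ ∃ x (y ~ x ∧ ¬ (walk x ∨ ...))))`, ending in a vertex of
color `c`, where `walk` is the existence of a walk to color `c₁` or `c₂` of length `L - j` at the
`j`-th place from the inside. -/
def forkFormula (c c₁ c₂ : C) (L : ℕ) : ℕ → Fin 2 → FOFormula C 2
  | 0, i => exNbr (col c) i
  | j + 1, i => exNbr (fun i => neg (or (walkFormula c₁ c₂ (L - j) i)
      (forkFormula c c₁ c₂ L j i))) i

/-- The meaning of `walkFormula`. -/
def HasWalk (G : ColoredGraph C V) (c c' : C) : ℕ → V → Prop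
  | 0, x => G.color x = some c ∨ G.color x = some c'
  | l + 1, x => ∃ y, G.graph.Adj x y ∧ HasWalk G c c' l y

/-- The meaning of `forkFormula`. -/
def Forks (G : ColoredGraph C V) (c c₁ c₂ : C) (L : ℕ) : ℕ → V → Prop
  | 0, x => ∃ y, G.graph.Adj x y ∧ G.color y = some c
  | j + 1, x => ∃ y, G.graph.Adj x y ∧ ¬ (HasWalk G c₁ c₂ (L - j) y ∨ Forks G c c₁ c₂ L j y)

theorem realize_exNbr {G : ColoredGraph C V} {F : Fin 2 → FOFormula C 2} {P : V → Prop}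
    (h : ∀ i v, (F i).Realize G v ↔ P (v i)) (i : Fin 2) (v : Fin 2 → V) :
    (exNbr F i).Realize G v ↔ ∃ y, G.graph.Adj (v i) y ∧ P y := by
  simp [exNbr, Realize, h, (Fin.two_add_one_ne i).symm]

theorem realize_walkFormula (G : ColoredGraph C V) (c c' : C) (l : ℕ) (i : Fin 2) (v : Fin 2 → V) :
    (walkFormula c c' l i).Realize G v ↔ HasWalk G c c' l (v i) := by
  induction l generalizing i v with
  | zero => simp [walkFormula, HasWalk, Realize]
  | succ l ih => exact realize_exNbr ih i v

theorem realize_forkFormula (G : ColoredGraph C V) (c c₁ c₂ : C) (L j : ℕ) (i : Fin 2)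
    (v : Fin 2 → V) :
    (forkFormula c c₁ c₂ L j i).Realize G v ↔ Forks G c c₁ c₂ L j (v i) := by
  induction j generalizing i v with
  | zero => exact realize_exNbr (P := fun y => G.color y = some c) (fun i v => by simp [Realize]) i v
  | succ j ih =>
    exact realize_exNbr
      (P := fun y => ¬ (HasWalk G c₁ c₂ (L - j) y ∨ Forks G c c₁ c₂ L j y))
      (fun i v => by simp [Realize, realize_walkFormula, ih]) i v

theorem freeVars_exNbr_subset {F : Fin 2 → FOFormula C 2} (i : Fin 2) :
    (exNbr F i).freeVars ⊆ {i} := by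
  intro x hx
  rw [exNbr, freeVars, Finset.mem_erase] at hx
  simpa [hx.1] using Fin.eq_or_eq_add_one i x

theorem freeVars_forkFormula_subset (c c₁ c₂ : C) (L j : ℕ) (i : Fin 2) :
    (forkFormula c c₁ c₂ L j i).freeVars ⊆ {i} := by
  cases j <;> exact freeVars_exNbr_subset i

theorem blocks_walkFormula (c c' : C) (l : ℕ) (i : Fin 2) :
    (walkFormula c c' l i).blocks (some true) = 0 := by
  induction l generalizing i with
  | zero => simp [walkFormula, blocks]
  | succ l ih => simp [walkFormula, exNbr, blocks, ih]

theorem blocks_exNbr (q : Option Bool) (F : Fin 2 → FOFormula C 2) (i : Fin 2) :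
    (exNbr F i).blocks q ≤ 1 + (exNbr F i).blocks (some true) := by
  simp only [exNbr, blocks]; split <;> simp

/-- Each nesting level costs one block. The negated walk formula is free of further cost: however
long the walk, its quantifiers form a single universal block, parallel to the one opened by the
negated inner formula. -/
theorem blocks_forkFormula (c c₁ c₂ : C) (L j : ℕ) (i : Fin 2) :
    (forkFormula c c₁ c₂ L j i).blocks (some true) ≤ j := by
  induction j generalizing i with
  | zero => simp [forkFormula, exNbr, blocks]
  | succ j ih =>
    have hf : (forkFormula c c₁ c₂ L j (i + 1)).blocks (some false) ≤ j + 1 := by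
      have h1 := ih (i + 1)
      have h2 : (forkFormula c c₁ c₂ L j (i + 1)).blocks (some false) ≤
          1 + (forkFormula c c₁ c₂ L j (i + 1)).blocks (some true) := by
        cases j <;> exact blocks_exNbr _ _ _
      omega
    have hw : (walkFormula c₁ c₂ (L - j) (i + 1)).blocks (some false) ≤ 1 := by
      have h1 := blocks_walkFormula c₁ c₂ (L - j) (i + 1)
      cases hl : L - j with
      | zero => simp [walkFormula, blocks]
      | succ l =>
        rw [hl] at h1
        have h2 := blocks_exNbr (some false) (walkFormula c₁ c₂ l) (i + 1)
        rw [walkFormula] at h1 ⊢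
        omega
    have hn := blocks_neg (some false)
      (or (walkFormula c₁ c₂ (L - j) (i + 1)) (forkFormula c c₁ c₂ L j (i + 1)))
    simp only [Option.map_some, Bool.not_false] at hn
    simp only [forkFormula, exNbr, blocks, if_true, hn]
    omega

theorem BoundedMorphism.hasWalk_iff {G : ColoredGraph C V} {H : ColoredGraph C W} {f : V → W}
    (hf : BoundedMorphism G H f) (c c' : C) (l : ℕ) (x : V) :
    HasWalk H c c' l (f x) ↔ HasWalk G c c' l x := by
  induction l generalizing x with
  | zero => simp [HasWalk, hf.color]
  | succ l ih => rw [HasWalk, hf.exists_adj]; simp [ih, HasWalk]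

/-- The formulas look only along edges. This carries their evaluation on a single glued ladder over
to the doubled, padded and upside-down graphs. -/
theorem BoundedMorphism.forks_iff {G : ColoredGraph C V} {H : ColoredGraph C W} {f : V → W}
    (hf : BoundedMorphism G H f) (c c₁ c₂ : C) (L j : ℕ) (x : V) :
    Forks H c c₁ c₂ L j (f x) ↔ Forks G c c₁ c₂ L j x := by
  induction j generalizing x with
  | zero => rw [Forks, hf.exists_adj]; simp [Forks, hf.color]
  | succ j ih => rw [Forks, hf.exists_adj]; simp [Forks, ih, hf.hasWalk_iff]

end ForkFormulas

/-! ### Ladders in terms of narrow and wide vertices. -/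

section Ladders

/-- A vertex of a ladder is narrow if it is joined to only one vertex of each neighboring rung. -/
def narrow (i : ℕ) (s : Bool) : Bool := xor s (decide (Odd i))

theorem ladderAdj_iff (i j : ℕ) (s r : Bool) :
    ladderAdj (i, s) (j, r) ↔
      (j = i + 1 ∨ i = j + 1) ∧ ¬ (narrow i s = true ∧ narrow j r = true) := by
  have h1 : ∀ (i : ℕ) (s r : Bool), ladderUp (i, s) (i + 1, r) ↔
      ¬ (narrow i s = true ∧ narrow (i + 1) r = true) := by
    intro i s r
    by_cases hi : Odd i
    · cases s <;> cases r <;> simp [ladderUp, narrow, hi, Nat.odd_add_one, ← Nat.not_odd_iff_even]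
    · cases s <;> cases r <;> simp [ladderUp, narrow, hi, ← Nat.not_odd_iff_even]
  have h2 : ∀ (i j : ℕ) (s r : Bool), j ≠ i + 1 → ¬ ladderUp (i, s) (j, r) :=
    fun i j s r h h' => h h'.1
  by_cases hj : j = i + 1
  · subst hj
    have := h2 (i + 1) i r s (by omega)
    simp only [ladderAdj, h1, this]
    simp
  · by_cases hi : i = j + 1
    · subst hi
      have := h2 (j + 1) j s r (by omega)
      simp only [ladderAdj, h1, this]
      simp [and_comm]
    · have := h2 i j s r hj
      have := h2 j i r s hi
      simp [ladderAdj, *]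

variable {C : Type*} (κ : Hue ↪ C) (m : ℕ)

/-- Narrowness in the upper ladder. -/
def narrowUp (u : Fin (2 * m - 1) × Bool) : Bool := narrow (u.1 - (m - 1)) u.2

/-- Narrowness in the lower ladder. -/
def narrowDown (t : Bool) (u : Fin (2 * m - 1) × Bool) : Bool :=
  narrow (m - 1 - u.1) (xor u.2 t)

variable {m}

theorem exists_narrowUp (p : Fin (2 * m - 1)) (b : Bool) : ∃ s, narrowUp m (p, s) = b :=
  ⟨xor b (decide (Odd (p - (m - 1)))), by simp [narrowUp, narrow]⟩

theorem exists_narrowDown (t : Bool) (p : Fin (2 * m - 1)) (b : Bool) :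
    ∃ s, narrowDown m t (p, s) = b :=
  ⟨xor (xor b (decide (Odd (m - 1 - p)))) t, by simp [narrowDown, narrow]⟩

theorem gluedLadders_adj (t : Bool) (u v : Fin (2 * m - 1) × Bool) :
    (gluedLadders κ m t).graph.Adj u v ↔
      (v.1.val = u.1.val + 1 ∨ u.1.val = v.1.val + 1) ∧
      ((m - 1 ≤ u.1.val ∧ m - 1 ≤ v.1.val ∧ ¬ (narrowUp m u = true ∧ narrowUp m v = true)) ∨
      (u.1.val ≤ m - 1 ∧ v.1.val ≤ m - 1 ∧
        ¬ (narrowDown m t u = true ∧ narrowDown m t v = true))) := by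
  simp only [gluedLadders, ladderAdj_iff, narrowUp, narrowDown]
  constructor
  · rintro (⟨h1, h2, h3, h4⟩ | ⟨h1, h2, h3, h4⟩)
    · exact ⟨by omega, .inl ⟨h1, h2, h4⟩⟩
    · exact ⟨by omega, .inr ⟨h1, h2, h4⟩⟩
  · rintro ⟨h3, ⟨h1, h2, h4⟩ | ⟨h1, h2, h4⟩⟩
    · exact .inl ⟨h1, h2, by omega, h4⟩
    · exact .inr ⟨h1, h2, by omega, h4⟩

theorem gluedLadders_color_middle (t : Bool) {u : Fin (2 * m - 1) × Bool} (hu : u.1.val = m - 1) :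
    (gluedLadders κ m t).color u = some (κ .green) := by
  simp [gluedLadders, hu]

/-! ### The strategy of Duplicator -/

/-- The relation between the narrowness of two vertices at distance `k` from the end of a chain of
rungs, when `a` quantifier alternations are left. -/
def Near (a k : ℕ) (b b' : Bool) : Prop :=
  b = b' ∨ (a + 1 ≤ k ∧ b = true ∧ b' = false) ∨ a + 2 ≤ k

/-- When widths differ, Duplicator goes to a wide vertex, which is always reachable. If Spoiler
stood on the narrow vertex, the next one must be wide too and the difference disappears. If Spoiler
stood on the wide vertex, the slack `a + 2 ≤ k` leaves `a + 1 ≤ k'`, enough for the harmless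
difference. -/
theorem Near.step {a k k' : ℕ} {b₁ b₂ c₁ : Bool} (h : Near a k b₁ b₂) (hk : k ≤ k' + 1)
    (hc : ¬ (b₁ = true ∧ c₁ = true)) : ∃ c₂, Near a k' c₁ c₂ ∧ ¬ (b₂ = true ∧ c₂ = true) := by
  by_cases hb : b₁ = b₂
  · exact ⟨c₁, .inl rfl, hb ▸ hc⟩
  · refine ⟨false, ?_, by simp⟩
    unfold Near at *
    cases b₁ <;> cases b₂ <;> cases c₁ <;> simp at h hc hb ⊢ <;> omega

theorem Near.of_succ {a k : ℕ} {b b' : Bool} (h : Near (a + 1) k b b') : Near a k b' b := by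
  unfold Near at *
  rcases h with h | h | h
  · exact .inl h.symm
  · exact .inr (.inr (by omega))
  · exact .inr (.inr (by omega))

/-- Vertices of two graphs of glued ladders on the same rung, with related narrowness in each of
the ladders that they belong to. -/
def RungNear (m : ℕ) (t t' : Bool) (a : ℕ) (u v : Fin (2 * m - 1) × Bool) : Prop :=
  u.1 = v.1 ∧
    (m - 1 ≤ u.1.val → Near a (2 * m - 2 - u.1) (narrowUp m u) (narrowUp m v)) ∧
    (u.1.val ≤ m - 1 → Near a u.1 (narrowDown m t u) (narrowDown m t' v))

theorem RungNear.of_succ {t t' : Bool} {a : ℕ} {u v : Fin (2 * m - 1) × Bool}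
    (h : RungNear m t t' (a + 1) u v) : RungNear m t' t a v u := by
  obtain ⟨p, s⟩ := u
  obtain ⟨q, r⟩ := v
  obtain ⟨h1, h2, h3⟩ := h
  obtain rfl : p = q := h1
  exact ⟨rfl, fun h => (h2 h).of_succ, fun h => (h3 h).of_succ⟩

/-- The green rung is at distance `m - 1 ≥ a + 2` from both ends, so there `Near` holds for any
widths. Hence a strategy that respects one ladder may ignore the other, and the gluing bits `t`,
`t'` do not matter. At distance 0 `Near` forces equal widths, hence equal end colors. -/
theorem localForth_rungNear (t t' : Bool) {a : ℕ} (ha : a + 3 ≤ m) :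
    LocalForth (gluedLadders κ m t) (gluedLadders κ m t') (RungNear m t t' a) := by
  refine ⟨?_, ?_, ?_⟩
  · rintro ⟨p, s⟩ ⟨q, r⟩ ⟨h1, h2, h3⟩
    obtain rfl : p = q := h1
    have hp := p.2
    by_cases hm : p.val = m - 1
    · rw [gluedLadders_color_middle κ t hm, gluedLadders_color_middle κ t' hm]
    by_cases htop : p.val = 2 * m - 2
    · have := h2 (by simp only; omega)
      simp only [Near, htop, narrowUp, narrow] at this
      simp only [Nat.sub_self] at this
      have hsr : s = r := by simpa using this
      simp [gluedLadders, hsr, htop]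
    by_cases hbot : p.val = 0
    · have := h3 (by simp only; omega)
      simp only [Near, hbot, narrowDown, narrow] at this
      have hsr : xor s t = xor r t' := by
        simpa only [Nat.add_one_ne_zero, Nat.le_zero_eq, OfNat.ofNat_ne_zero, Nat.add_eq_zero_iff,
          one_ne_zero, and_false, false_and, or_false, Bool.xor_left_inj] using this
      rw [hbot] at hm htop
      simp only [gluedLadders, hsr, hm, htop, hbot, if_true, if_false]
    · simp [gluedLadders, hm, htop, hbot]
  · rintro ⟨p, s⟩ ⟨q, r⟩ ⟨h1, h2, h3⟩ ⟨p', s'⟩ hadj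
    obtain rfl : p = q := h1
    rw [gluedLadders_adj] at hadj
    have hp := p.2
    have hp' := p'.2
    obtain ⟨hc, ⟨hu, hv, hn⟩ | ⟨hu, hv, hn⟩⟩ := hadj <;> simp only at hc hu hv h2 h3
    · obtain ⟨c, hc1, hc2⟩ := (h2 hu).step (k' := 2 * m - 2 - p') (by omega) hn
      obtain ⟨r', rfl⟩ := exists_narrowUp p' c
      -- The condition for the lower ladder applies only if `p'` is the green rung, where it is
      -- vacuous.
      exact ⟨(p', r'), ⟨rfl, fun _ => hc1, fun h => .inr (.inr (by simp only at h ⊢; omega))⟩,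
        (gluedLadders_adj ..).2 ⟨hc, .inl ⟨hu, hv, hc2⟩⟩⟩
    · obtain ⟨c, hc1, hc2⟩ := (h3 hu).step (k' := p') (by omega) hn
      obtain ⟨r', rfl⟩ := exists_narrowDown t' p' c
      exact ⟨(p', r'), ⟨rfl, fun h => .inr (.inr (by simp only at h ⊢; omega)), fun _ => hc1⟩,
        (gluedLadders_adj ..).2 ⟨hc, .inr ⟨hu, hv, hc2⟩⟩⟩
  · rintro ⟨p, s⟩
    by_cases hp : m - 1 ≤ p.val
    · exact ⟨(p, s), rfl, fun _ => .inl rfl, fun h => .inr (.inr (by simp only at h ⊢; omega))⟩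
    · obtain ⟨r, hr⟩ := exists_narrowDown t' p (narrowDown m t (p, s))
      exact ⟨(p, r), rfl, fun h => absurd h hp, fun _ => .inl hr.symm⟩

theorem le_altDepth_of_distinguishes_double {φ : FOFormula C 2}
    (h : φ.Distinguishes (gluedLadders κ m false).double (gluedLadders κ m true).double) :
    m - 1 ≤ φ.altDepth := by
  by_contra! hlt
  obtain ⟨hfree, hG, hH⟩ := h
  have hloc := fun (t t' : Bool) (a : ℕ) (ha : a < m - 2) =>
    localForth_rungNear (m := m) κ t t' (a := a) (by omega)
  refine hH fun w => realize_sentence_of_forth (d := m - 2)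
    (E := fun a x y => RungNear m false true a (Sum.elim id id x) (Sum.elim id id y))
    (U := fun a x y => RungNear m true false a (Sum.elim id id y) (Sum.elim id id x))
    (fun a ha => (hloc _ _ a ha).double) (fun a ha => (hloc _ _ a ha).double)
    (fun a x y => RungNear.of_succ) (fun a x y => RungNear.of_succ)
    (fun a ha => (hloc _ _ a ha).double_total) (fun a ha => (hloc _ _ a ha).double_total)
    φ hfree (by omega) w w (hG w)

theorem le_altDepth_of_distinguishes_pad {φ : FOFormula C 2} {p : ℕ}
    (h : φ.Distinguishes ((gluedLadders κ m false).double.pad p)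
      ((gluedLadders κ m true).double.pad p)) :
    m - 1 ≤ φ.altDepth := by
  by_contra! hlt
  obtain ⟨hfree, hG, hH⟩ := h
  have hloc := fun (t t' : Bool) (a : ℕ) (ha : a < m - 2) =>
    localForth_rungNear (m := m) κ t t' (a := a) (by omega)
  have hforth := fun (t t' : Bool) (a : ℕ) (ha : a < m - 2) =>
    (hloc t t' a ha).double.pad (hloc t t' a ha).double_total p
  have htot := fun (t t' : Bool) (a : ℕ) (ha : a < m - 2) =>
    liftRel_total (p := p) (hloc t t' a ha).double_total
  have hsucc : ∀ (t t' : Bool) (a : ℕ) x y,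
      Sum.LiftRel (fun x y => RungNear m t t' (a + 1) (Sum.elim id id x) (Sum.elim id id y))
        (Eq : Fin p → Fin p → Prop) x y →
      Sum.LiftRel (fun x y => RungNear m t' t a (Sum.elim id id x) (Sum.elim id id y))
        (Eq : Fin p → Fin p → Prop) y x := by
    rintro t t' a _ _ (h | h)
    · exact .inl h.of_succ
    · exact .inr h.symm
  refine hH fun w => realize_sentence_of_forth (d := m - 2)
    (E := fun a x y => Sum.LiftRel
      (fun x y => RungNear m false true a (Sum.elim id id x) (Sum.elim id id y)) Eq x y)
    (U := fun a x y => Sum.LiftRel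
      (fun x y => RungNear m true false a (Sum.elim id id x) (Sum.elim id id y)) Eq y x)
    (fun a ha => hforth _ _ a ha) (fun a ha => hforth _ _ a ha)
    (fun a x y => hsucc _ _ a x y) (fun a x y => hsucc _ _ a y x)
    (fun a ha => htot _ _ a ha) (fun a ha => htot _ _ a ha)
    φ hfree (by omega) w w (hG w)

/-! ### The distinguishing sentence -/

/-- Descending through wide vertices is always possible. -/
theorem hasWalk_of_eq (hm : 2 ≤ m) (t : Bool) {l : ℕ} {u : Fin (2 * m - 1) × Bool}
    (hu : u.1.val = l) : HasWalk (gluedLadders κ m t) (κ .apricot) (κ .cyan) l u := by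
  induction l generalizing u with
  | zero =>
    have h1 : ¬ 0 = 2 * m - 2 := by omega
    have h2 : ¬ 0 = m - 1 := by omega
    simp only [HasWalk, gluedLadders, h1, h2, hu, if_true, if_false]
    split_ifs <;> simp
  | succ l ih =>
    have hlt := u.1.2
    let p : Fin (2 * m - 1) := ⟨l, by omega⟩
    by_cases hp : m - 1 ≤ l
    · obtain ⟨s, hs⟩ := exists_narrowUp p false
      exact ⟨(p, s), (gluedLadders_adj ..).2 ⟨.inr hu, .inl ⟨by omega, hp, by simp [hs]⟩⟩, ih rfl⟩
    · obtain ⟨s, hs⟩ := exists_narrowDown t p false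
      refine ⟨(p, s), (gluedLadders_adj ..).2 ⟨.inr hu, .inr ⟨by omega, ?_, by simp [hs]⟩⟩, ih rfl⟩
      simp only [p]; omega

theorem not_hasWalk_of_lt (t : Bool) {l : ℕ} {u : Fin (2 * m - 1) × Bool}
    (hu : l < u.1.val) : ¬ HasWalk (gluedLadders κ m t) (κ .apricot) (κ .cyan) l u := by
  induction l generalizing u with
  | zero =>
    simp only [HasWalk, gluedLadders]
    have : ¬ u.1.val = 0 := by omega
    cases u.2 <;> split_ifs <;> simp_all
  | succ l ih =>
    rintro ⟨v, hadj, hv⟩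
    have := ((gluedLadders_adj ..).1 hadj).1
    exact ih (by omega) hv

/-- The color of the narrow vertex on the top rung. -/
def topHue (m : ℕ) : Bool → Hue
  | false => if Odd (m - 1) then .red else .blue
  | true => if Odd (m - 1) then .apricot else .cyan

theorem color_eq_topHue_iff (hm : 2 ≤ m) (t : Bool) (u : Fin (2 * m - 1) × Bool) :
    (gluedLadders κ m t).color u = some (κ (topHue m false)) ↔
      u.1.val = 2 * m - 2 ∧ narrowUp m u = true := by
  obtain ⟨p, s⟩ := u
  have hne : ¬ 2 * m - 2 = m - 1 := by omega
  by_cases htop : p.val = 2 * m - 2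
  · have h1 : 2 * m - 2 - (m - 1) = m - 1 := by omega
    by_cases hodd : Odd (m - 1) <;> cases s <;>
      simp [gluedLadders, topHue, narrowUp, narrow, htop, hne, h1, hodd]
  · simp only [gluedLadders, topHue, htop, false_and, iff_false, if_false]
    split_ifs <;> simp

/-- In the upper ladder a vertex is wide exactly when it has a narrow neighbor on the rung above,
and narrowness there is the negation of the previous formula. The walk formula rules out neighbors
on the rung below. -/
theorem forks_gluedLadders_iff (hm : 2 ≤ m) (t : Bool) {j : ℕ} (hj : j ≤ m - 2)
    {u : Fin (2 * m - 1) × Bool} (hu : u.1.val + j + 1 = 2 * m - 2) :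
    Forks (gluedLadders κ m t) (κ (topHue m false)) (κ .apricot) (κ .cyan) (2 * m - 5) j u ↔
      narrowUp m u = false := by
  have hup : ∀ u : Fin (2 * m - 1) × Bool, m - 1 ≤ u.1.val → u.1.val < 2 * m - 2 →
      narrowUp m u = false → ∃ v, (gluedLadders κ m t).graph.Adj u v ∧ v.1.val = u.1.val + 1 ∧
        narrowUp m v = true := by
    intro u h1 h2 h
    let p : Fin (2 * m - 1) := ⟨u.1 + 1, by omega⟩
    obtain ⟨s, hs⟩ := exists_narrowUp p true
    exact ⟨(p, s), (gluedLadders_adj ..).2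
      ⟨.inl rfl, .inl ⟨by omega, by simp only [p]; omega, by simp [h]⟩⟩, rfl, hs⟩
  have hnar : ∀ u v : Fin (2 * m - 1) × Bool, m - 1 ≤ u.1.val →
      (gluedLadders κ m t).graph.Adj u v → u.1.val < v.1.val → narrowUp m v = true →
      narrowUp m u = false := by
    intro u v hu hadj hlt hv
    obtain ⟨h1, ⟨-, -, h2⟩ | ⟨h2, h3, -⟩⟩ := (gluedLadders_adj ..).1 hadj
    · simpa [hv] using h2
    · omega
  induction j generalizing u with
  | zero =>
    simp only [Forks, color_eq_topHue_iff κ hm]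
    constructor
    · rintro ⟨v, hadj, hv, hn⟩
      exact hnar u v (by omega) hadj (by omega) hn
    · intro h
      obtain ⟨v, h1, h2, h3⟩ := hup u (by omega) (by omega) h
      exact ⟨v, h1, by omega, h3⟩
  | succ j ih =>
    have ih' := fun (v : Fin (2 * m - 1) × Bool) (hv : v.1.val = u.1.val + 1) =>
      ih (by omega) (u := v) (by omega)
    constructor
    · rintro ⟨v, hadj, hv⟩
      rw [not_or] at hv
      have h1 := ((gluedLadders_adj ..).1 hadj).1
      -- Here `u` is on rung `2 * m - 4 - j`, so a lower neighbor is on rung `2 * m - 5 - j`,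
      -- exactly the walk length; this fixes the parameter `2 * m - 5`.
      have h2 : v.1.val = u.1.val + 1 :=
        h1.resolve_right fun h => hv.1 (hasWalk_of_eq κ hm t (by omega))
      exact hnar u v (by omega) hadj (by omega) (by simpa [ih' v h2] using hv.2)
    · intro h
      obtain ⟨v, h1, h2, h3⟩ := hup u (by omega) (by omega) h
      refine ⟨v, h1, not_or.2 ⟨not_hasWalk_of_lt κ t (by omega), fun h' => ?_⟩⟩
      simpa [h3] using (ih' v h2).1 h'

/-- Exchanging the colors of the top vertices of the two ladders. -/
def swapHue : Hue → Hue
  | .red => .apricot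
  | .blue => .cyan
  | .green => .green
  | .apricot => .red
  | .cyan => .blue

theorem swapHue_injective : Function.Injective swapHue := by
  intro a b; cases a <;> cases b <;> simp [swapHue]

/-- Turning two glued ladders upside down. -/
def flipVertex (m : ℕ) (t : Bool) (u : Fin (2 * m - 1) × Bool) : Fin (2 * m - 1) × Bool :=
  (u.1.rev, xor u.2 t)

theorem flipVertex_flipVertex (t : Bool) (u : Fin (2 * m - 1) × Bool) :
    flipVertex m t (flipVertex m t u) = u := by
  simp [flipVertex]

theorem gluedLadders_adj_flipVertex (t : Bool) (u v : Fin (2 * m - 1) × Bool) :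
    (gluedLadders κ m t).graph.Adj (flipVertex m t u) (flipVertex m t v) ↔
      (gluedLadders κ m t).graph.Adj u v := by
  obtain ⟨p, s⟩ := u
  obtain ⟨q, r⟩ := v
  have h1 : ∀ x : Fin (2 * m - 1), x.rev.val - (m - 1) = m - 1 - x := fun x => by
    rw [Fin.val_rev]; omega
  have h2 : ∀ x : Fin (2 * m - 1), m - 1 - x.rev = x - (m - 1) := fun x => by
    rw [Fin.val_rev]; omega
  have h3 : ∀ x : Fin (2 * m - 1), m - 1 ≤ x.rev.val ↔ x.val ≤ m - 1 := fun x => by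
    rw [Fin.val_rev]; omega
  have h4 : ∀ x : Fin (2 * m - 1), x.rev.val ≤ m - 1 ↔ m - 1 ≤ x.val := fun x => by
    rw [Fin.val_rev]; omega
  simp only [gluedLadders, flipVertex, h1, h2, h3, h4, Bool.xor_assoc, Bool.xor_self,
    Bool.xor_false]
  exact or_comm

theorem boundedMorphism_flipVertex (hm : 2 ≤ m) (t : Bool) :
    BoundedMorphism (gluedLadders κ m t)
      (gluedLadders ((⟨swapHue, swapHue_injective⟩ : Hue ↪ Hue).trans κ) m t) (flipVertex m t) := by
  refine ⟨fun ⟨p, s⟩ => ?_, fun u z => ?_⟩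
  · have hp := p.2
    have h1 : p.rev.val = m - 1 ↔ p.val = m - 1 := by rw [Fin.val_rev]; omega
    have h2 : p.rev.val = 2 * m - 2 ↔ p.val = 0 := by rw [Fin.val_rev]; omega
    have h3 : p.rev.val = 0 ↔ p.val = 2 * m - 2 := by rw [Fin.val_rev]; omega
    simp only [gluedLadders, flipVertex, h1, h2, h3, Bool.xor_assoc, Bool.xor_self, Bool.xor_false]
    split_ifs <;> first | rfl | (exfalso; omega)
  · change (gluedLadders κ m t).graph.Adj _ _ ↔ _
    constructor
    · intro h
      refine ⟨flipVertex m t z, flipVertex_flipVertex t z, ?_⟩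
      rwa [← gluedLadders_adj_flipVertex, flipVertex_flipVertex]
    · rintro ⟨x', rfl, h⟩
      exact (gluedLadders_adj_flipVertex ..).2 h

/-- Some green vertex satisfies the fork formulas of both ladders. -/
def HasDoubleFork {V : Type*} (m : ℕ) (G : ColoredGraph C V) : Prop :=
  ∃ x, G.color x = some (κ .green) ∧
    Forks G (κ (topHue m false)) (κ .apricot) (κ .cyan) (2 * m - 5) (m - 2) x ∧
    Forks G (κ (topHue m true)) (κ .red) (κ .blue) (2 * m - 5) (m - 2) x

/-- On the green rung the wide vertex of each ladder is its own left vertex, so one vertex is wide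
in both only if left was glued to left. The lower ladder is handled by turning the graph upside down
and exchanging the colors. -/
theorem hasDoubleFork_gluedLadders (hm : 2 ≤ m) (t : Bool) :
    HasDoubleFork κ m (gluedLadders κ m t) ↔ t = false := by
  let κ' : Hue ↪ C := (⟨swapHue, swapHue_injective⟩ : Hue ↪ Hue).trans κ
  have hgreen : ∀ u : Fin (2 * m - 1) × Bool,
      (gluedLadders κ m t).color u = some (κ .green) ↔ u.1.val = m - 1 := by
    intro u
    simp only [gluedLadders]
    split_ifs with h1 <;> simp [h1]
  have hfork : ∀ u : Fin (2 * m - 1) × Bool, u.1.val = m - 1 →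
      ((Forks (gluedLadders κ m t) (κ (topHue m false)) (κ .apricot) (κ .cyan) (2 * m - 5) (m - 2) u
        ↔ u.2 = false) ∧
      (Forks (gluedLadders κ m t) (κ (topHue m true)) (κ .red) (κ .blue) (2 * m - 5) (m - 2) u
        ↔ xor u.2 t = false)) := by
    intro u hu
    constructor
    · rw [forks_gluedLadders_iff κ hm t le_rfl (by omega)]
      simp [narrowUp, narrow, hu]
    · rw [← (boundedMorphism_flipVertex κ hm t).forks_iff]
      have htop : κ (topHue m true) = κ' (topHue m false) := by
        simp only [topHue]; split_ifs <;> rfl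
      have hrev : u.1.rev.val = m - 1 := by rw [Fin.val_rev]; omega
      rw [htop]
      refine (forks_gluedLadders_iff κ' hm t le_rfl (by simp only [flipVertex]; omega)).trans ?_
      simp only [narrowUp, narrow, flipVertex, hrev]
      simp
  constructor
  · rintro ⟨u, hu, h1, h2⟩
    obtain ⟨h3, h4⟩ := hfork u ((hgreen u).1 hu)
    simpa [h3.1 h1] using h4.1 h2
  · rintro rfl
    let u : Fin (2 * m - 1) × Bool := (⟨m - 1, by omega⟩, false)
    have hu : u.1.val = m - 1 := rfl
    exact ⟨u, (hgreen u).2 hu, (hfork u hu).1.2 rfl, (hfork u hu).2.2 rfl⟩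

theorem hasDoubleFork_double {V : Type*} (G : ColoredGraph C V) :
    HasDoubleFork κ m G.double ↔ HasDoubleFork κ m G := by
  have hf := boundedMorphism_double G
  simp only [HasDoubleFork, ← hf.forks_iff, ← hf.color]
  constructor
  · rintro ⟨x, hx⟩; exact ⟨_, hx⟩
  · rintro ⟨x, hx⟩; exact ⟨.inl x, hx⟩

theorem hasDoubleFork_pad {V : Type*} (G : ColoredGraph C V) (p : ℕ) :
    HasDoubleFork κ m (G.pad p) ↔ HasDoubleFork κ m G := by
  have hf := boundedMorphism_pad G p
  simp only [HasDoubleFork, ← hf.forks_iff, ← hf.color]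
  constructor
  · rintro ⟨x | j, hx⟩
    · exact ⟨x, hx⟩
    · simp [ColoredGraph.pad] at hx
  · rintro ⟨x, hx⟩; exact ⟨.inl x, hx⟩

open FOFormula in
theorem exists_distinguishes_of_hasDoubleFork {V W : Type*} [Nonempty W] (hm : 2 ≤ m)
    {G : ColoredGraph C V} {H : ColoredGraph C W}
    (hG : HasDoubleFork κ m G) (hH : ¬ HasDoubleFork κ m H) :
    ∃ φ : FOFormula C 2, φ.Distinguishes G H ∧ φ.altDepth ≤ m - 1 := by
  let ψ := forkFormula (κ (topHue m false)) (κ .apricot) (κ .cyan) (2 * m - 5) (m - 2) 0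
  let χ := forkFormula (κ (topHue m true)) (κ .red) (κ .blue) (2 * m - 5) (m - 2) 0
  have hψ : ψ.freeVars ⊆ {0} := freeVars_forkFormula_subset ..
  have hχ : χ.freeVars ⊆ {0} := freeVars_forkFormula_subset ..
  have hψb : ψ.blocks (some true) ≤ m - 2 := blocks_forkFormula ..
  have hχb : χ.blocks (some true) ≤ m - 2 := blocks_forkFormula ..
  refine ⟨ex 0 (and (col (κ .green) 0) (and ψ χ)), ⟨?_, fun v => ?_, fun h => ?_⟩, ?_⟩
  · rw [freeVars, Finset.erase_eq_empty_iff, or_iff_not_imp_left]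
    intro hne
    exact (Finset.subset_singleton_iff.1
      (Finset.union_subset (by simp [freeVars]) (Finset.union_subset hψ hχ))).resolve_left hne
  · simpa [HasDoubleFork, Realize, ψ, χ, realize_forkFormula] using hG
  · have := h fun _ => Classical.arbitrary W
    exact hH (by simpa [HasDoubleFork, Realize, ψ, χ, realize_forkFormula] using this)
  · simp only [altDepth, blocks, reduceCtorEq, if_false]
    omega

end Ladders

/-! ### Bounds on the alternation function. -/

section AlternationFunction

variable {C : Type*} {V W : Type*} {G : ColoredGraph C V} {H : ColoredGraph C W}

theorem minAltDepth_le {k : ℕ} {φ : FOFormula C k} (h : φ.Distinguishes G H) :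
    minAltDepth k G H ≤ φ.altDepth :=
  Nat.sInf_le ⟨φ, h, rfl⟩

theorem le_minAltDepth {k a : ℕ} (hGH : Distinguishable k G H)
    (h : ∀ φ : FOFormula C k, φ.Distinguishes G H → a ≤ φ.altDepth) : a ≤ minAltDepth k G H := by
  obtain ⟨φ, hφ⟩ := hGH
  obtain ⟨ψ, hψ, heq⟩ := Nat.sInf_mem
    (s := {a | ∃ φ : FOFormula C k, φ.Distinguishes G H ∧ φ.altDepth = a}) ⟨_, φ, hφ, rfl⟩
  exact (h ψ hψ).trans heq.le

theorem le_of_mem_altValues {n a : ℕ} (hn : 1 ≤ n) (ha : a ∈ altValues C 2 n) : a ≤ n + 1 := by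
  obtain ⟨V, W, _, _, G, H, hV, hW, hGH, rfl⟩ := ha
  have : Nonempty V := Fintype.card_pos_iff.1 (by omega)
  obtain ⟨φ, hφ, hd⟩ := hGH.exists_altDepth_le
  rw [Nat.card_eq_fintype_card, hV] at hd
  exact (minAltDepth_le hφ).trans hd

open FOFormula in
theorem altValues_nonempty (c : C) {n : ℕ} (hn : 1 ≤ n) : (altValues C 2 n).Nonempty := by
  let G : Option C → ColoredGraph C (Fin n) := fun o => ⟨⊥, fun _ => o⟩
  have : NeZero n := ⟨by omega⟩
  refine ⟨_, Fin n, Fin n, inferInstance, inferInstance, G (some c), G none, by simp, by simp,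
    ⟨ex 0 (col c 0), by simp [freeVars], ?_, ?_⟩, rfl⟩ <;> simp [Realize, G]

theorem sub_one_mem_altValues (κ : Hue ↪ C) {m n : ℕ} (hm : 2 ≤ m) (hn : 8 * m - 4 ≤ n) :
    ∃ a ∈ altValues C 2 n, m - 1 ≤ a := by
  let p := n - (8 * m - 4)
  have hcard : Fintype.card
      (((Fin (2 * m - 1) × Bool) ⊕ (Fin (2 * m - 1) × Bool)) ⊕ Fin p) = n := by
    simp [p]; omega
  have : Nonempty (((Fin (2 * m - 1) × Bool) ⊕ (Fin (2 * m - 1) × Bool)) ⊕ Fin p) :=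
    Fintype.card_pos_iff.1 (by omega)
  obtain ⟨φ, hφ, -⟩ := exists_distinguishes_of_hasDoubleFork κ hm
    (G := (gluedLadders κ m false).double.pad p) (H := (gluedLadders κ m true).double.pad p)
    (by simp [hasDoubleFork_pad, hasDoubleFork_double, hasDoubleFork_gluedLadders κ hm])
    (by simp [hasDoubleFork_pad, hasDoubleFork_double, hasDoubleFork_gluedLadders κ hm])
  exact ⟨_, ⟨_, _, inferInstance, inferInstance, _, _, hcard, hcard, ⟨φ, hφ⟩, rfl⟩,
    le_minAltDepth ⟨φ, hφ⟩ fun ψ hψ => le_altDepth_of_distinguishes_pad κ hψ⟩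

end AlternationFunction

theorem theorem4 {C : Type*} (κ : Hue ↪ C) :
    (∀ n : ℕ, 1 ≤ n →
      IsGreatest (altValues C 2 n) (altFunction C 2 n) ∧
      (n : ℝ) / 8 - 2 < (altFunction C 2 n : ℝ) ∧
      altFunction C 2 n ≤ n + 1) ∧
    (∀ m : ℕ, 2 ≤ m →
      Fintype.card ((Fin (2 * m - 1) × Bool) ⊕ (Fin (2 * m - 1) × Bool)) = 8 * m - 4 ∧
      Distinguishable 2 (gluedLadders κ m false).double (gluedLadders κ m true).double ∧
      minAltDepth 2 (gluedLadders κ m false).double (gluedLadders κ m true).double = m - 1) := by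
  refine ⟨fun n hn => ?_, fun m hm => ?_⟩
  · have hbdd : BddAbove (altValues C 2 n) := ⟨n + 1, fun a ha => le_of_mem_altValues hn ha⟩
    have hmem : altFunction C 2 n ∈ altValues C 2 n :=
      Nat.sSup_mem (altValues_nonempty (κ .red) hn) hbdd
    refine ⟨⟨hmem, fun a ha => le_csSup hbdd ha⟩, ?_, le_of_mem_altValues hn hmem⟩
    -- With `m = n / 8` one has `n < 8 * m + 8`, and `m - 1` is a lower bound for the maximum. For
    -- `n < 16` the inequality is trivial.
    have hlt : n < 8 * altFunction C 2 n + 16 := by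
      by_cases hn16 : 16 ≤ n
      · obtain ⟨a, ha, hma⟩ := sub_one_mem_altValues κ (m := n / 8) (n := n) (by omega) (by omega)
        have : a ≤ altFunction C 2 n := le_csSup hbdd ha
        omega
      · omega
    have : (n : ℝ) < 8 * altFunction C 2 n + 16 := by exact_mod_cast hlt
    linarith
  · have : Nonempty (Fin (2 * m - 1) × Bool) := ⟨⟨0, by omega⟩, false⟩
    obtain ⟨φ, hφ, hd⟩ := exists_distinguishes_of_hasDoubleFork κ hm
      (G := (gluedLadders κ m false).double) (H := (gluedLadders κ m true).double)
      (by simp [hasDoubleFork_double, hasDoubleFork_gluedLadders κ hm])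
      (by simp [hasDoubleFork_double, hasDoubleFork_gluedLadders κ hm])
    refine ⟨by simp; omega, ⟨φ, hφ⟩, le_antisymm ((minAltDepth_le hφ).trans hd) ?_⟩
    exact le_minAltDepth ⟨φ, hφ⟩ fun ψ hψ => le_altDepth_of_distinguishes_double κ hψ
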